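/- Let $S^3$ be the unit sphere in $\mathbb{R}^4$ with its standard smooth structure. For a smooth Riemannian metric on $S^3$, a closed curve is a continuous map $\alpha:\mathbb{R}/\mathbb{Z}\to S^3$; its length is its length with respect to the Riemannian distance (the supremum, over all finite subdivisions of $[0,1]$, of the sums of the distances between consecutive points of the curve). The curve $2\alpha$ is $\alpha$ traversed twice, $(2\alpha)(s)=\alpha(2s)$. For a closed curve $\alpha$ of length at most $L$ let $$[\alpha]_L=\inf\{\operatorname{length}(\beta) : \beta \text{ is homotopic to } \alpha \text{ through closed curves of length at most } L\},$$ where homotopies are free homotopies of closed curves. Proposition. For every pair of real numbers $K>L>0$ there exist a smooth Riemannian metric on $S^3$ and a smooth simple closed curve $\alpha$ in $S^3$ (an injective closed curve which is smooth with nowhere vanishing velocity) such that $\operatorname{length}(\alpha)\le K$, $\operatorname{length}(2\alpha)\le L$ and $$[\alpha]_K>[2\alpha]_L .$$ -/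

import Mathlib

open Bundle Manifold Set
open scoped ContDiff ENNReal

noncomputable section

namespace CurveLength

/-- A smooth Riemannian metric on the manifold `M`: a smooth, symmetric, positive definite bilinear
form on the tangent bundle. -/
abbrev RiemannianMetricOn {E : Type*} [NormedAddCommGroup E] [NormedSpace ℝ E]
    {H : Type*} [TopologicalSpace H] (I : ModelWithCorners ℝ E H)
    (M : Type*) [TopologicalSpace M] [ChartedSpace H M] [IsManifold I ∞ M] :=
  ContMDiffRiemannianMetric I ∞ E (fun x : M => TangentSpace I x)

section

variable {E : Type*} [NormedAddCommGroup E] [NormedSpace ℝ E]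
  {H : Type*} [TopologicalSpace H] {I : ModelWithCorners ℝ E H}
  {M : Type*} [TopologicalSpace M] [ChartedSpace H M] [IsManifold I ∞ M]

/-- The Riemannian distance of the metric `g`: the infimum of the `g`-lengths
`∫ √(g(γ', γ'))` of the `C¹` paths joining `x` to `y`. -/
def riemDist (g : RiemannianMetricOn I M) (x y : M) : ℝ≥0∞ :=
  letI : RiemannianBundle (fun x : M => TangentSpace I x) := ⟨g.toRiemannianMetric⟩
  riemannianEDist I x y

/-- The length, for the Riemannian metric `g`, of a continuous closed curve `γ : ℝ/ℤ → M`: the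
supremum over all finite subdivisions `u 0 ≤ u 1 ≤ … ≤ u n` of `[0, 1]` of the sums of the
Riemannian distances between consecutive points (it is infinite when `γ` is not rectifiable). -/
def loopLength (g : RiemannianMetricOn I M) (γ : C(UnitAddCircle, M)) : ℝ≥0∞ :=
  ⨆ p : ℕ × { u : ℕ → ℝ // Monotone u ∧ ∀ i, u i ∈ Icc (0 : ℝ) 1 },
    ∑ i ∈ Finset.range p.1,
      riemDist g (γ (p.2.1 i : UnitAddCircle)) (γ (p.2.1 (i + 1) : UnitAddCircle))

/-- `α` and `β` are freely homotopic through closed curves of `g`-length at most `L`. -/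
def HomotopicThrough (g : RiemannianMetricOn I M) (L : ℝ) (α β : C(UnitAddCircle, M)) : Prop :=
  ∃ F : ContinuousMap.Homotopy α β, ∀ t : unitInterval, loopLength g (F.curry t) ≤ ENNReal.ofReal L

/-- `[α]_L`: the infimum of the lengths of the closed curves that are homotopic to `α` through
closed curves of length at most `L`. It is meant for curves `α` of length at most `L`. -/
def minLength (g : RiemannianMetricOn I M) (L : ℝ) (α : C(UnitAddCircle, M)) : ℝ≥0∞ :=
  ⨅ (β : C(UnitAddCircle, M)) (_ : HomotopicThrough g L α β), loopLength g β

/-- `α` is a smooth simple closed curve: injective on `ℝ/ℤ`, smooth, and with nowhere vanishing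
velocity. -/
def IsSmoothSimpleClosed (I : ModelWithCorners ℝ E H) (α : C(UnitAddCircle, M)) : Prop :=
  Function.Injective α ∧
    ContMDiff 𝓘(ℝ, ℝ) I ∞ (fun t : ℝ => α (t : UnitAddCircle)) ∧
    ∀ t : ℝ, mfderiv 𝓘(ℝ, ℝ) I (fun t : ℝ => α (t : UnitAddCircle)) t ≠ 0

end

/-- The closed curve `2α`, that is, `α` traversed twice. -/
def twice {M : Type*} [TopologicalSpace M] (α : C(UnitAddCircle, M)) : C(UnitAddCircle, M) :=
  α.comp ⟨fun s => s + s, by fun_prop⟩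

/-- The three-sphere, as the unit sphere of `ℝ⁴`, with its standard smooth structure. -/
abbrev S3 : Type := Metric.sphere (0 : EuclideanSpace ℝ (Fin 4)) 1

end CurveLength

end

/-!
Write `S³ ⊂ ℂ²` with coordinates `(z, w)`, and let `α` be the great circle `w = 0`. It is the core
of a Möbius band whose boundary is the `(2, 1)` torus curve `β : s ↦ (√(1 - r²) e(s)², r e(s))`,
where `e(s) = exp (2πis)` and `r` is small; pushing `2α` across the band (`bandHomotopy`) turns it
into `β`. The metric is conformal to the round one, with factor

  `A² |w|⁶ + B² |r² z - √(1 - r²) w²|²`.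

Here `r² z - √(1 - r²) w²` vanishes on `β`, so that `β` is very short, of length of order `A r³`.
The constant `B`, of order `L / r²`, keeps all the curves of the band shorter than `L`, and `A`, a
multiple of `K`, makes the metric large away from the circle `w = 0`.

The curve `α` itself is stuck because of a parity obstruction. Call a loop odd if `z` has no
continuous square root on it; on loops avoiding `z = 0` this says that the winding number of `z` is
odd. A function whose differential is bounded by the metric is `1`-Lipschitz for the Riemannian
distance (`enorm_sub_le_riemDist`), and applying this to a pair of functions `G`, `z G` shows that
`z` is nearly constant on a loop that is short compared with the size of `G` at one of its points,
so that the loop is not odd (`hasContinuousSqrt_of_loopLength_le`). There are two uses.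

* With `G` a multiple of `w⁴`: an odd loop of length at most `K` in `|z| ≥ 1/2` does not touch
  `|z| = 1/2`. Hence loops stay odd and in `|z| > 1/2` along a homotopy from `α` through loops of
  length at most `K` (`not_hasContinuousSqrt_of_homotopicThrough`).
* With `G` a multiple of `(r² z - √(1 - r²) w²)²`: an odd loop has a point with
  `|r² z - √(1 - r²) w²| ≥ r² |z|`, as otherwise `z` would have a square root close to a multiple of
  `w`. So odd loops in `|z| ≥ 1/2` have length at least of order `B r⁴`, that is `L r²`
  (`le_loopLength_of_not_hasContinuousSqrt`).

Since `A r³` is of order `K r³`, the curve `β` is shorter than every odd loop once `r` is small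
compared with `L / K`.
-/

open Bundle Manifold Set
open scoped ContDiff ENNReal

namespace CurveLength

/-! ### Metrics on the three-sphere conformal to the round one -/

section pullback

variable {V W : Type*} [NormedAddCommGroup V] [NormedSpace ℝ V]
  [NormedAddCommGroup W] [InnerProductSpace ℝ W]

/-- The bilinear form `(u, v) ↦ c ⟨D u, D v⟩`, written as a composition of continuous linear maps so
that its smooth dependence on `c` and `D` is visible. -/
noncomputable def scaledPullbackInner (c : ℝ) (D : V →L[ℝ] W) : V →L[ℝ] V →L[ℝ] ℝ :=
  ((ContinuousLinearMap.compL ℝ V W ℝ).flip D) ∘L ((innerSL ℝ : W →L[ℝ] W →L[ℝ] ℝ) ∘L (c • D))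

lemma scaledPullbackInner_apply (c : ℝ) (D : V →L[ℝ] W) (u v : V) :
    scaledPullbackInner c D u v = c * inner ℝ (D u) (D v) :=
  real_inner_smul_left _ _ _

lemma contDiff_scaledPullbackInner :
    ContDiff ℝ ∞ (fun p : ℝ × (V →L[ℝ] W) => scaledPullbackInner p.1 p.2) := by
  have h1 : ContDiff ℝ ∞ (fun p : ℝ × (V →L[ℝ] W) =>
      (innerSL ℝ : W →L[ℝ] W →L[ℝ] ℝ) ∘L (p.1 • p.2)) :=
    contDiff_const.clm_comp (contDiff_fst.smul contDiff_snd)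
  have h2 : ContDiff ℝ ∞ (fun D : V →L[ℝ] W => (ContinuousLinearMap.compL ℝ V W ℝ).flip D) :=
    ContinuousLinearMap.contDiff _
  exact (h2.comp contDiff_snd).clm_comp h1

end pullback

/-- The ambient space of `S3`. -/
abbrev E4 : Type := EuclideanSpace ℝ (Fin 4)

theorem fact_finrank_E4 : Fact (Module.finrank ℝ E4 = 3 + 1) := ⟨by simp⟩

section metric

attribute [local instance] fact_finrank_E4

/-- The differential at `x` of the inclusion of the three-sphere in `ℝ⁴`. -/
noncomputable def inclDeriv (x : S3) : TangentSpace (𝓡 3) x →L[ℝ] E4 :=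
  mvfderiv (𝓡 3) ((↑) : S3 → E4) x

lemma inclDeriv_injective (x : S3) : Function.Injective (inclDeriv x) :=
  injective_mvfderiv_subtypeVal_sphere x

/-- The Euclidean inner product on the tangent space of the sphere at `x`, multiplied by `c`. -/
noncomputable def scaledInner (c : ℝ) (x : S3) :
    TangentSpace (𝓡 3) x →L[ℝ] TangentSpace (𝓡 3) x →L[ℝ] ℝ :=
  let D : EuclideanSpace ℝ (Fin 3) →L[ℝ] E4 := inclDeriv x
  scaledPullbackInner c D

lemma scaledInner_apply (c : ℝ) (x : S3) (v w : TangentSpace (𝓡 3) x) :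
    scaledInner c x v w = c * inner ℝ (inclDeriv x v) (inclDeriv x w) :=
  let D : EuclideanSpace ℝ (Fin 3) →L[ℝ] E4 := inclDeriv x
  have h : ∀ a b : EuclideanSpace ℝ (Fin 3), scaledPullbackInner c D a b = c * inner ℝ (D a) (D b) :=
    scaledPullbackInner_apply c D
  h v w

lemma isVonNBounded_scaledInner (c : ℝ) (hc : 0 < c) (x : S3) :
    Bornology.IsVonNBounded ℝ {v : TangentSpace (𝓡 3) x | scaledInner c x v v < 1} := by
  let D : EuclideanSpace ℝ (Fin 3) →L[ℝ] E4 := inclDeriv x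
  have hD : Function.Injective D := inclDeriv_injective x
  obtain ⟨k, -, hk⟩ := D.toLinearMap.exists_antilipschitzWith (LinearMap.ker_eq_bot.2 hD)
  have hD2 : ∀ v : EuclideanSpace ℝ (Fin 3), scaledInner c x v v = c * ‖D v‖ ^ 2 := fun v => by
    rw [← real_inner_self_eq_norm_sq]
    exact scaledInner_apply c x v v
  change Bornology.IsVonNBounded ℝ {v : EuclideanSpace ℝ (Fin 3) | scaledInner c x v v < 1}
  refine (NormedSpace.isVonNBounded_ball ℝ (EuclideanSpace ℝ (Fin 3))
    (k * (1 / c + 1) + 1)).subset fun v hv => ?_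
  have hv := (hD2 v).symm.trans_lt hv
  have h1 : ‖v‖ ≤ k * ‖D v‖ := by simpa using hk.le_mul_norm (by simp) v
  have h2 : ‖D v‖ ^ 2 < 1 / c := by rw [lt_div_iff₀ hc]; linarith
  have h3 : ‖D v‖ ≤ 1 / c + 1 := by nlinarith [norm_nonneg (D v), sq_nonneg (‖D v‖ - 1)]
  rw [mem_ball_zero_iff]
  nlinarith [k.coe_nonneg, mul_le_mul_of_nonneg_left h3 k.coe_nonneg]

lemma contMDiff_scaledInner {f : S3 → ℝ} (hf : ContMDiff (𝓡 3) 𝓘(ℝ, ℝ) ∞ f) :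
    ContMDiff (𝓡 3) ((𝓡 3).prod 𝓘(ℝ, EuclideanSpace ℝ (Fin 3) →L[ℝ]
        EuclideanSpace ℝ (Fin 3) →L[ℝ] ℝ)) ∞
      (fun x : S3 => TotalSpace.mk' (EuclideanSpace ℝ (Fin 3) →L[ℝ]
        EuclideanSpace ℝ (Fin 3) →L[ℝ] ℝ)
        (E := fun x : S3 => TangentSpace (𝓡 3) x →L[ℝ] TangentSpace (𝓡 3) x →L[ℝ] ℝ)
        x (scaledInner (f x) x)) := by
  intro x₀
  rw [contMDiffAt_hom_bundle]
  refine ⟨contMDiffAt_id, ?_⟩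
  have hD : ContMDiffAt (𝓡 3) 𝓘(ℝ, EuclideanSpace ℝ (Fin 3) →L[ℝ] E4) ∞
      (inTangentCoordinates (𝓡 3) 𝓘(ℝ, E4) id (fun x : S3 => (x : E4))
        (mfderiv (𝓡 3) 𝓘(ℝ, E4) (fun x : S3 => (x : E4))) x₀) x₀ :=
    ContMDiffAt.mfderiv_const (n := ∞) (contMDiff_coe_sphere (n := 3) x₀) (by norm_num)
  set D := inTangentCoordinates (𝓡 3) 𝓘(ℝ, E4) id (fun x : S3 => (x : E4))
        (mfderiv (𝓡 3) 𝓘(ℝ, E4) (fun x : S3 => (x : E4))) x₀ with hDdef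
  have h := contDiff_scaledPullbackInner.contMDiff.contMDiffAt.comp x₀ ((hf x₀).prodMk_space hD)
  refine h.congr_of_eventuallyEq ?_
  have hs : (trivializationAt (EuclideanSpace ℝ (Fin 3)) (TangentSpace (𝓡 3)) x₀).baseSet
    ∈ nhds x₀ := (trivializationAt _ _ _).open_baseSet.mem_nhds
      (FiberBundle.mem_baseSet_trivializationAt' x₀)
  filter_upwards [hs] with x hx
  ext v w
  rw [inCoordinates_apply_eq₂ hx hx (Set.mem_univ _)]
  -- `D` is the differential of the inclusion read in the trivialization around `x₀`
  have key : ∀ u : EuclideanSpace ℝ (Fin 3), D x u = inclDeriv x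
      ((trivializationAt (EuclideanSpace ℝ (Fin 3)) (TangentSpace (𝓡 3)) x₀).symm x u) := by
    intro u
    simp only [hDdef, inTangentCoordinates, ContinuousLinearMap.inCoordinates]
    -- the trivialization of the tangent bundle of `ℝ⁴` is the identity
    erw [TangentBundle.continuousLinearMapAt_model_space]
    change inclDeriv x ((trivializationAt (EuclideanSpace ℝ (Fin 3)) (TangentSpace (𝓡 3)) x₀).symmL
      ℝ x u) = _
    rw [Bundle.Trivialization.symmL_apply _ hx]
  simp only [Function.comp_apply, scaledInner_apply, scaledPullbackInner_apply, key]
  simp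

/-- The metric on the three-sphere conformal to the round one, with conformal factor `f`:
`g(u, v) = f ⟨u, v⟩`. -/
noncomputable def conformalMetric (f : S3 → ℝ) (hf : ContMDiff (𝓡 3) 𝓘(ℝ, ℝ) ∞ f)
    (hpos : ∀ x, 0 < f x) : RiemannianMetricOn (𝓡 3) S3 where
  inner x := scaledInner (f x) x
  symm x v w := by rw [scaledInner_apply, scaledInner_apply, real_inner_comm]
  pos x v hv := by
    rw [scaledInner_apply]
    exact mul_pos (hpos x) (real_inner_self_pos.2
      ((map_ne_zero_iff _ (inclDeriv_injective x)).2 hv))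
  isVonNBounded x := isVonNBounded_scaledInner _ (hpos x) x
  contMDiff := contMDiff_scaledInner hf

end metric

/-! ### Distances and lengths for a conformal metric -/

section distance

attribute [local instance] fact_finrank_E4

variable {f : S3 → ℝ} {hf : ContMDiff (𝓡 3) 𝓘(ℝ, ℝ) ∞ f} {hpos : ∀ x, 0 < f x}

lemma enorm_conformalMetric (x : S3) (v : TangentSpace (𝓡 3) x) :
    letI : RiemannianBundle (fun x : S3 => TangentSpace (𝓡 3) x) :=
      ⟨(conformalMetric f hf hpos).toRiemannianMetric⟩
    ‖v‖ₑ = ENNReal.ofReal (√(f x) * ‖inclDeriv x v‖) := by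
  let _ : RiemannianBundle (fun x : S3 => TangentSpace (𝓡 3) x) :=
      ⟨(conformalMetric f hf hpos).toRiemannianMetric⟩
  have h : ‖v‖ = √(f x) * ‖inclDeriv x v‖ := by
    rw [norm_eq_sqrt_real_inner, ← Real.sqrt_sq (norm_nonneg (inclDeriv x v)),
      ← Real.sqrt_mul (hpos x).le, ← real_inner_self_eq_norm_sq]
    exact congrArg Real.sqrt (scaledInner_apply (f x) x v v)
  rw [← ofReal_norm, h]

lemma contDiff_coe_comp {γ : ℝ → S3} (hγ : ContMDiff 𝓘(ℝ, ℝ) (𝓡 3) 1 γ) :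
    ContDiff ℝ 1 (fun t => (γ t : E4)) :=
  (ContMDiff.comp (contMDiff_coe_sphere (n := 3)) hγ).contDiff

lemma inclDeriv_mfderiv {γ : ℝ → S3} (hγ : ContMDiff 𝓘(ℝ, ℝ) (𝓡 3) 1 γ) (t : ℝ) :
    inclDeriv (γ t) (mfderiv 𝓘(ℝ, ℝ) (𝓡 3) γ t 1) = deriv (fun t => (γ t : E4)) t := by
  have h1 := mfderiv_comp (I := 𝓘(ℝ, ℝ)) (I' := 𝓡 3) (I'' := 𝓘(ℝ, E4)) (f := γ)
    (g := ((↑) : S3 → E4)) t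
    ((contMDiff_coe_sphere (n := 3) (m := 1) (γ t)).mdifferentiableAt one_ne_zero)
    ((hγ t).mdifferentiableAt one_ne_zero)
  have h2 := DFunLike.congr_fun h1 (1 : ℝ)
  rw [mfderiv_eq_fderiv] at h2
  exact h2.symm.trans fderiv_apply_one_eq_deriv

lemma riemDist_le_of_speed_le {γ : ℝ → S3} (hγ : ContMDiff 𝓘(ℝ, ℝ) (𝓡 3) 1 γ) {C : ℝ}
    (hC : ∀ t, √(f (γ t)) * ‖deriv (fun t => (γ t : E4)) t‖ ≤ C) {a b : ℝ} (hab : a ≤ b) :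
    riemDist (conformalMetric f hf hpos) (γ a) (γ b) ≤ ENNReal.ofReal (C * (b - a)) := by
  let _ : RiemannianBundle (fun x : S3 => TangentSpace (𝓡 3) x) :=
      ⟨(conformalMetric f hf hpos).toRiemannianMetric⟩
  have hC0 : 0 ≤ C := le_trans (by positivity) (hC 0)
  refine (riemannianEDist_le_pathELength hγ.contMDiffOn rfl rfl hab).trans ?_
  rw [pathELength_eq_lintegral_mfderiv_Icc]
  calc _ ≤ ∫⁻ _ in Icc a b, ENNReal.ofReal C := by
        refine MeasureTheory.lintegral_mono fun t => ?_
        rw [enorm_conformalMetric, inclDeriv_mfderiv hγ]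
        exact ENNReal.ofReal_le_ofReal (hC t)
    _ = ENNReal.ofReal (C * (b - a)) := by
        rw [MeasureTheory.setLIntegral_const, Real.volume_Icc, ← ENNReal.ofReal_mul hC0]

/-- A function whose differential is bounded by the `g`-norm is `1`-Lipschitz for the Riemannian
distance of `g`. -/
lemma enorm_sub_le_riemDist {H : E4 → ℂ} (hH : ContDiff ℝ 1 H)
    (hdH : ∀ x : S3, ∀ v, ‖fderiv ℝ H x v‖ ≤ √(f x) * ‖v‖) (x y : S3) :
    ‖H y - H x‖ₑ ≤ riemDist (conformalMetric f hf hpos) x y := by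
  let _ : RiemannianBundle (fun x : S3 => TangentSpace (𝓡 3) x) :=
      ⟨(conformalMetric f hf hpos).toRiemannianMetric⟩
  refine le_of_forall_gt fun r hr => ?_
  obtain ⟨γ, rfl, rfl, hγ, hlen, -, -⟩ :=
    exists_lt_locally_constant_of_riemannianEDist_lt hr (zero_lt_one (α := ℝ))
  refine lt_of_le_of_lt ?_ hlen
  rw [pathELength_eq_lintegral_mfderiv_Icc]
  have hc := contDiff_coe_comp hγ
  refine (enorm_sub_le_lintegral_deriv_of_contDiffOn_Icc (f := fun t => H (γ t))
    (hH.comp hc).contDiffOn zero_le_one).trans (MeasureTheory.lintegral_mono fun t => ?_)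
  rw [enorm_conformalMetric, inclDeriv_mfderiv hγ, ← ofReal_norm]
  refine ENNReal.ofReal_le_ofReal (le_trans (le_of_eq ?_) (hdH _ _))
  congr 1
  exact fderiv_comp_deriv t (hH.differentiable one_ne_zero _) (hc.differentiable one_ne_zero t)

lemma loopLength_le_of_speed_le {γ : C(UnitAddCircle, S3)}
    (hγ : ContMDiff 𝓘(ℝ, ℝ) (𝓡 3) 1 (fun t : ℝ => γ (t : UnitAddCircle))) {C : ℝ}
    (hC : ∀ t : ℝ, √(f (γ t)) * ‖deriv (fun t : ℝ => (γ (t : UnitAddCircle) : E4)) t‖ ≤ C) :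
    loopLength (conformalMetric f hf hpos) γ ≤ ENNReal.ofReal C := by
  have hC0 : 0 ≤ C := le_trans (by positivity) (hC 0)
  refine iSup_le fun ⟨n, u, hu, hmem⟩ => ?_
  calc _ ≤ ∑ i ∈ Finset.range n, ENNReal.ofReal (C * (u (i + 1) - u i)) :=
        Finset.sum_le_sum fun i _ => riemDist_le_of_speed_le hγ hC (hu i.le_succ)
    _ = ENNReal.ofReal (C * (u n - u 0)) := by
        rw [← ENNReal.ofReal_sum_of_nonneg fun i _ =>
          mul_nonneg hC0 (sub_nonneg.2 (hu i.le_succ)), ← Finset.mul_sum, Finset.sum_range_sub]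
    _ ≤ ENNReal.ofReal C := by
        refine ENNReal.ofReal_le_ofReal ?_
        have h1 := (hmem n).2
        have h2 := (hmem 0).1
        nlinarith

end distance

lemma riemDist_comm (g : RiemannianMetricOn (𝓡 3) S3) (x y : S3) :
    riemDist g x y = riemDist g y x := by
  let _ : RiemannianBundle (fun x : S3 => TangentSpace (𝓡 3) x) := ⟨g.toRiemannianMetric⟩
  exact riemannianEDist_comm

lemma riemDist_le_loopLength (g : RiemannianMetricOn (𝓡 3) S3) (γ : C(UnitAddCircle, S3))
    (p q : UnitAddCircle) : riemDist g (γ p) (γ q) ≤ loopLength g γ := by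
  obtain ⟨a, ha, rfl⟩ : ∃ a ∈ Ico (0 : ℝ) 1, (a : UnitAddCircle) = p := by
    have := (AddCircle.coe_image_Ico_eq (1 : ℝ) 0).symm ▸ mem_univ p
    simpa using this
  obtain ⟨b, hb, rfl⟩ : ∃ b ∈ Ico (0 : ℝ) 1, (b : UnitAddCircle) = q := by
    have := (AddCircle.coe_image_Ico_eq (1 : ℝ) 0).symm ▸ mem_univ q
    simpa using this
  wlog hab : a ≤ b generalizing a b
  · rw [riemDist_comm]
    exact this b hb a ha (le_of_not_ge hab)
  let u : ℕ → ℝ := fun i => if i = 0 then a else b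
  have hu : Monotone u := monotone_nat_of_le_succ fun i => by
    by_cases h : i = 0 <;> simp [u, h, hab]
  have hmem : ∀ i, u i ∈ Icc (0 : ℝ) 1 := fun i => by
    by_cases h : i = 0
    · simpa [u, h] using ⟨ha.1, ha.2.le⟩
    · simpa [u, h] using ⟨hb.1, hb.2.le⟩
  refine le_trans (le_of_eq ?_) (le_iSup _ (⟨1, ⟨u, hu, hmem⟩⟩ :
    ℕ × { u : ℕ → ℝ // Monotone u ∧ ∀ i, u i ∈ Icc (0 : ℝ) 1 }))
  simp [u]

/-! ### Continuous square roots of complex functions -/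

section sqrt

variable {X : Type*} [TopologicalSpace X]

/-- The complex function `a` has a continuous square root. A nowhere vanishing function on the
circle has one precisely when its winding number around `0` is even. -/
def HasContinuousSqrt (a : X → ℂ) : Prop :=
  ∃ q : X → ℂ, Continuous q ∧ ∀ x, q x ^ 2 = a x

lemma hasContinuousSqrt_const (c : ℂ) : HasContinuousSqrt fun _ : X => c := by
  obtain ⟨q, hq⟩ := IsAlgClosed.exists_pow_nat_eq c zero_lt_two
  exact ⟨fun _ => q, continuous_const, fun _ => hq⟩

lemma HasContinuousSqrt.mul {a b : X → ℂ} (ha : HasContinuousSqrt a) (hb : HasContinuousSqrt b) :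
    HasContinuousSqrt fun x => a x * b x := by
  obtain ⟨p, hp, hpa⟩ := ha
  obtain ⟨q, hq, hqb⟩ := hb
  exact ⟨fun x => p x * q x, hp.mul hq, fun x => by rw [mul_pow, hpa, hqb]⟩

lemma hasContinuousSqrt_of_norm_sub_one_lt {a : X → ℂ} (ha : Continuous a)
    (h : ∀ x, ‖a x - 1‖ < 1) : HasContinuousSqrt a := by
  have hs : ∀ x, a x ∈ Complex.slitPlane := fun x => by
    simpa using Complex.mem_slitPlane_of_norm_lt_one (h x)
  refine ⟨fun x => Complex.exp (Complex.log (a x) / 2), ?_, fun x => ?_⟩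
  · exact Complex.continuous_exp.comp ((ha.clog hs).div_const 2)
  · rw [← Complex.exp_nat_mul, Nat.cast_ofNat, mul_div_cancel₀ _ two_ne_zero,
      Complex.exp_log (Complex.slitPlane_ne_zero (hs x))]

/-- Two functions that are close relative to their size differ by a factor with values in the
disc of radius `1` around `1`, where the principal branch of the square root is continuous. -/
lemma HasContinuousSqrt.of_norm_sub_lt {a b : X → ℂ} (ha : HasContinuousSqrt a)
    (hac : Continuous a) (hbc : Continuous b) (h : ∀ x, ‖b x - a x‖ < ‖a x‖) :
    HasContinuousSqrt b := by
  have ha0 : ∀ x, a x ≠ 0 := fun x => norm_pos_iff.1 ((norm_nonneg _).trans_lt (h x))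
  have hq : HasContinuousSqrt fun x => b x / a x := by
    refine hasContinuousSqrt_of_norm_sub_one_lt (hbc.div hac ha0) fun x => ?_
    rw [div_sub_one (ha0 x), norm_div, div_lt_one (norm_pos_iff.2 (ha0 x))]
    exact h x
  convert ha.mul hq using 2 with x
  rw [mul_div_cancel₀ _ (ha0 x)]

lemma HasContinuousSqrt.of_norm_sub_lt' {a b : X → ℂ} (hb : HasContinuousSqrt b)
    (hac : Continuous a) (hbc : Continuous b) (h : ∀ x, ‖b x - a x‖ < ‖a x‖) :
    HasContinuousSqrt a := by
  have ha0 : ∀ x, a x ≠ 0 := fun x => norm_pos_iff.1 ((norm_nonneg _).trans_lt (h x))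
  obtain ⟨p, hp, hpa⟩ : HasContinuousSqrt fun x => b x / a x := by
    refine hasContinuousSqrt_of_norm_sub_one_lt (hbc.div hac ha0) fun x => ?_
    rw [div_sub_one (ha0 x), norm_div, div_lt_one (norm_pos_iff.2 (ha0 x))]
    exact h x
  have hb0 : ∀ x, b x ≠ 0 := fun x hx => by simpa [hx] using h x
  have hp0 : ∀ x, p x ≠ 0 := fun x hx => by
    have := hpa x
    rw [hx, zero_pow two_ne_zero, eq_comm, div_eq_zero_iff] at this
    exact this.elim (hb0 x) (ha0 x)
  obtain ⟨q, hq, hqb⟩ := hb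
  refine ⟨fun x => q x / p x, hq.div hp hp0, fun x => ?_⟩
  rw [div_pow, hqb, hpa, div_div_cancel₀ (hb0 x)]

end sqrt

/-- The standard parametrization `t ↦ exp (2πit)` of the unit circle of `ℂ`. -/
noncomputable def unitLoop : C(UnitAddCircle, ℂ) where
  toFun x := Circle.coeHom (AddCircle.toCircle x)
  continuous_toFun := (show Continuous ((↑) : Circle → ℂ) by fun_prop).comp AddCircle.continuous_toCircle

lemma unitLoop_coe (t : ℝ) : unitLoop (t : UnitAddCircle) =
    Complex.exp (2 * Real.pi * t * Complex.I) := by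
  change ((AddCircle.toCircle (t : UnitAddCircle) : Circle) : ℂ) = _
  rw [AddCircle.toCircle_apply_mk, Circle.coe_exp]
  simp

lemma norm_unitLoop (x : UnitAddCircle) : ‖unitLoop x‖ = 1 :=
  Circle.norm_coe (AddCircle.toCircle x)

lemma unitLoop_add (x y : UnitAddCircle) : unitLoop (x + y) = unitLoop x * unitLoop y := by
  change Circle.coeHom (AddCircle.toCircle (x + y)) = _
  rw [AddCircle.toCircle_add, map_mul]
  rfl

lemma unitLoop_injective : Function.Injective unitLoop := fun _ _ h =>
  AddCircle.injective_toCircle one_ne_zero (Circle.coe_injective h)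

lemma not_hasContinuousSqrt_unitLoop : ¬ HasContinuousSqrt unitLoop := by
  rintro ⟨q, hq, hqa⟩
  -- on `ℝ`, a square root of `t ↦ exp (2πit)` is one of the two functions `± exp (πit)`,
  -- which are not `1`-periodic
  have hg : Continuous fun t : ℝ => Complex.exp (Real.pi * t * Complex.I) := by fun_prop
  have hf : Continuous fun t : ℝ => q (t : UnitAddCircle) :=
    hq.comp (AddCircle.continuous_mk' 1)
  have hsq : EqOn ((fun t : ℝ => q (t : UnitAddCircle)) ^ 2)
      ((fun t : ℝ => Complex.exp (Real.pi * t * Complex.I)) ^ 2) univ := fun t _ => by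
    simp only [Pi.pow_apply]
    rw [hqa, unitLoop_coe, ← Complex.exp_nat_mul]
    congr 1
    push_cast
    ring
  have h1 : q ((1 : ℝ) : UnitAddCircle) = q ((0 : ℝ) : UnitAddCircle) := by
    congr 1
    simp
  have hpi : Complex.exp (Real.pi * (1 : ℝ) * Complex.I) = -1 := by simp [Complex.exp_pi_mul_I]
  rcases isPreconnected_univ.eq_or_eq_neg_of_sq_eq hf.continuousOn hg.continuousOn hsq
    (fun _ => Complex.exp_ne_zero _) with h | h
  · have e1 := h (mem_univ 1)
    have e0 := h (mem_univ 0)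
    simp only [hpi] at e1
    simp only [Complex.ofReal_zero, mul_zero, zero_mul, Complex.exp_zero] at e0
    rw [h1, e0] at e1
    norm_num at e1
  · have e1 := h (mem_univ 1)
    have e0 := h (mem_univ 0)
    simp only [Pi.neg_apply, hpi] at e1
    simp only [Pi.neg_apply, Complex.ofReal_zero, mul_zero, zero_mul, Complex.exp_zero] at e0
    rw [h1, e0] at e1
    norm_num at e1

/-- In a continuous family of loops in `ℂ`, suppose that a loop without continuous square root
which stays at distance at least `c` from `0` in fact stays at distance more than `c`. If the first
loop of the family is of this kind, then so are all the others. -/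
lemma not_hasContinuousSqrt_of_path {X : Type*} [TopologicalSpace X] [CompactSpace X] {c : ℝ}
    (hc : 0 < c) (G : C(unitInterval, C(X, ℂ)))
    (hG : ∀ t, (∀ x, c ≤ ‖G t x‖) → ¬ HasContinuousSqrt (G t) → ∀ x, c < ‖G t x‖)
    (h0 : ∀ x, c < ‖G 0 x‖) (h0' : ¬ HasContinuousSqrt (G 0)) (t : unitInterval) :
    (∀ x, c < ‖G t x‖) ∧ ¬ HasContinuousSqrt (G t) := by
  set T : Set unitInterval := {t | (∀ x, c < ‖G t x‖) ∧ ¬ HasContinuousSqrt (G t)}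
  have hnear : ∀ t, ∀ᶠ t' in nhds t, ∀ x, ‖G t' x - G t x‖ < c := fun t => by
    filter_upwards [Metric.continuousAt_iff'.1 G.continuous.continuousAt c hc] with t' ht' x
    rw [← dist_eq_norm]
    exact (ContinuousMap.dist_apply_le_dist x).trans_lt ht'
  -- `T` is clopen: nearby loops have square roots simultaneously, and `hG` gives closedness
  have hopen : IsOpen T := by
    rw [isOpen_iff_mem_nhds]
    rintro t ⟨ht, ht'⟩
    have hU : IsOpen {g : C(X, ℂ) | MapsTo g univ {z | c < ‖z‖}} :=
      ContinuousMap.isOpen_setOfPred_mapsTo isCompact_univ (isOpen_lt continuous_const continuous_norm)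
    filter_upwards [hnear t, (hU.preimage G.continuous).mem_nhds (show _ from fun x _ => ht x)]
      with t' h1 h2
    exact ⟨fun x => h2 (mem_univ x), fun hs => ht' (hs.of_norm_sub_lt' (G t).continuous
      (G t').continuous fun x => (h1 x).trans (ht x))⟩
  have hclosed : IsClosed T := by
    rw [← closure_subset_iff_isClosed]
    intro t ht
    have hle : ∀ x, c ≤ ‖G t x‖ := fun x => by
      have hcl : IsClosed {t | c ≤ ‖G t x‖} := isClosed_le continuous_const
        (continuous_norm.comp ((continuous_eval_const x).comp G.continuous))
      exact closure_minimal (fun t' (ht' : t' ∈ T) => (ht'.1 x).le) hcl ht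
    obtain ⟨t', h1, ht', ht''⟩ := mem_closure_iff_nhds.1 ht _ (hnear t)
    have hs : ¬ HasContinuousSqrt (G t) := fun hs => ht'' (hs.of_norm_sub_lt' (G t').continuous
      (G t).continuous fun x => by
        rw [norm_sub_rev]
        exact (h1 x).trans (ht' x))
    exact ⟨hG t hle hs, hs⟩
  have := IsClopen.eq_univ ⟨hclosed, hopen⟩ ⟨0, h0, h0'⟩
  exact this.ge (mem_univ t)

/-! ### Complex coordinates and loops on tori -/

/-- The first complex coordinate on `ℝ⁴ = ℂ²`. -/
noncomputable def zCoord : E4 →L[ℝ] ℂ :=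
  (EuclideanSpace.proj 0 : E4 →L[ℝ] ℝ).smulRight 1 +
    (EuclideanSpace.proj 1 : E4 →L[ℝ] ℝ).smulRight Complex.I

/-- The second complex coordinate on `ℝ⁴ = ℂ²`. -/
noncomputable def wCoord : E4 →L[ℝ] ℂ :=
  (EuclideanSpace.proj 2 : E4 →L[ℝ] ℝ).smulRight 1 +
    (EuclideanSpace.proj 3 : E4 →L[ℝ] ℝ).smulRight Complex.I

/-- The point of `ℝ⁴` with complex coordinates `z` and `w`. -/
noncomputable def ofCoords : ℂ × ℂ →L[ℝ] E4 :=
  LinearMap.toContinuousLinearMap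
    { toFun := fun p => !₂[p.1.re, p.1.im, p.2.re, p.2.im]
      map_add' := fun p q => by ext i; fin_cases i <;> simp
      map_smul' := fun c p => by ext i; fin_cases i <;> simp }

lemma zCoord_ofCoords (z w : ℂ) : zCoord (ofCoords (z, w)) = z := by
  apply Complex.ext <;> simp [zCoord, ofCoords]

lemma wCoord_ofCoords (z w : ℂ) : wCoord (ofCoords (z, w)) = w := by
  apply Complex.ext <;> simp [wCoord, ofCoords]

lemma norm_sq_eq (x : E4) : ‖x‖ ^ 2 = ‖zCoord x‖ ^ 2 + ‖wCoord x‖ ^ 2 := by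
  rw [EuclideanSpace.norm_sq_eq, Complex.sq_norm, Complex.sq_norm, Complex.normSq_apply,
    Complex.normSq_apply]
  simp [zCoord, wCoord, Fin.sum_univ_four]
  ring

lemma norm_zCoord_le (x : E4) : ‖zCoord x‖ ≤ ‖x‖ :=
  le_of_sq_le_sq (by nlinarith [norm_sq_eq x, sq_nonneg ‖wCoord x‖]) (norm_nonneg x)

lemma norm_wCoord_le (x : E4) : ‖wCoord x‖ ≤ ‖x‖ :=
  le_of_sq_le_sq (by nlinarith [norm_sq_eq x, sq_nonneg ‖zCoord x‖]) (norm_nonneg x)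

lemma norm_sq_ofCoords (z w : ℂ) : ‖ofCoords (z, w)‖ ^ 2 = ‖z‖ ^ 2 + ‖w‖ ^ 2 := by
  rw [norm_sq_eq, zCoord_ofCoords, wCoord_ofCoords]

lemma norm_coe_S3 (x : S3) : ‖(x : E4)‖ = 1 := mem_sphere_zero_iff_norm.1 x.2

/-- A loop on a torus (or on a circle, when `a` or `b` vanishes) in the three-sphere:
`z = a e(s)ᵐ`, `w = b e(s)`, where `e(s) = exp (2πis)`. -/
noncomputable def torusLoop (m : ℕ) (a b : ℝ) (h : a ^ 2 + b ^ 2 = 1) : C(UnitAddCircle, S3) where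
  toFun x := ⟨ofCoords (a * unitLoop x ^ m, b * unitLoop x), by
    rw [mem_sphere_zero_iff_norm, ← sq_eq_sq₀ (norm_nonneg _) zero_le_one, norm_sq_ofCoords]
    simp [norm_unitLoop, h]⟩
  continuous_toFun := by fun_prop

lemma coe_torusLoop (m : ℕ) (a b : ℝ) (h : a ^ 2 + b ^ 2 = 1) (x : UnitAddCircle) :
    (torusLoop m a b h x : E4) = ofCoords (a * unitLoop x ^ m, b * unitLoop x) := rfl

lemma hasDerivAt_unitLoop (t : ℝ) : HasDerivAt (fun t : ℝ => unitLoop (t : UnitAddCircle))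
    (2 * Real.pi * Complex.I * unitLoop (t : UnitAddCircle)) t := by
  simp only [unitLoop_coe]
  have h : HasDerivAt (fun t : ℝ => 2 * Real.pi * (t : ℂ) * Complex.I)
      (2 * Real.pi * 1 * Complex.I) t :=
    ((Complex.ofRealCLM.hasDerivAt (x := t)).const_mul _).mul_const _
  convert h.cexp using 1
  ring

lemma hasDerivAt_torusLoop (m : ℕ) (a b : ℝ) (h : a ^ 2 + b ^ 2 = 1) (t : ℝ) :
    HasDerivAt (fun t : ℝ => (torusLoop m a b h (t : UnitAddCircle) : E4))
      (ofCoords (2 * Real.pi * m * a * Complex.I * unitLoop (t : UnitAddCircle) ^ m,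
        2 * Real.pi * b * Complex.I * unitLoop (t : UnitAddCircle))) t := by
  have h1 := ((hasDerivAt_unitLoop t).pow m).const_mul (a : ℂ)
  have h2 := (hasDerivAt_unitLoop t).const_mul (b : ℂ)
  have h3 := ofCoords.hasFDerivAt.comp_hasDerivAt t (h1.prodMk h2)
  refine h3.congr_deriv (congrArg ofCoords (Prod.ext ?_ ?_))
  · rcases m with _ | m
    · simp
    · simp only [Nat.add_sub_cancel, pow_succ]
      ring
  · simp only
    ring

lemma norm_deriv_torusLoop {m : ℕ} (a b : ℝ) (h : a ^ 2 + b ^ 2 = 1) (t : ℝ) :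
    ‖deriv (fun t : ℝ => (torusLoop m a b h (t : UnitAddCircle) : E4)) t‖ ^ 2 =
      (2 * Real.pi) ^ 2 * ((m * a) ^ 2 + b ^ 2) := by
  rw [(hasDerivAt_torusLoop m a b h t).deriv, norm_sq_ofCoords]
  simp only [norm_mul, norm_pow, norm_unitLoop, Complex.norm_I, Complex.norm_real,
    Complex.norm_natCast, Complex.norm_ofNat, mul_pow, Real.norm_eq_abs, sq_abs]
  ring

section smooth

attribute [local instance] fact_finrank_E4

lemma contMDiff_torusLoop (m : ℕ) (a b : ℝ) (h : a ^ 2 + b ^ 2 = 1) :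
    ContMDiff 𝓘(ℝ, ℝ) (𝓡 3) ∞ (fun t : ℝ => torusLoop m a b h (t : UnitAddCircle)) := by
  have hu : ContDiff ℝ ∞ (fun t : ℝ => unitLoop (t : UnitAddCircle)) := by
    simp only [unitLoop_coe]
    exact (((contDiff_const.mul Complex.ofRealCLM.contDiff).mul contDiff_const)).cexp
  have hc : ContDiff ℝ ∞ (fun t : ℝ => (torusLoop m a b h (t : UnitAddCircle) : E4)) :=
    ofCoords.contDiff.comp ((contDiff_const.mul (hu.pow m)).prodMk (contDiff_const.mul hu))
  exact ContMDiff.codRestrict_sphere (n := 3) hc.contMDiff _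

lemma isSmoothSimpleClosed_torusLoop_one (h : (1 : ℝ) ^ 2 + 0 ^ 2 = 1) :
    IsSmoothSimpleClosed (𝓡 3) (torusLoop 1 1 0 h) := by
  refine ⟨fun x y hxy => unitLoop_injective ?_, contMDiff_torusLoop 1 1 0 h, fun t ht => ?_⟩
  · have := congrArg (fun p : S3 => zCoord p) hxy
    simpa [coe_torusLoop, zCoord_ofCoords] using this
  · have h1 := inclDeriv_mfderiv ((contMDiff_torusLoop 1 1 0 h).of_le (by norm_num)) t
    have h2 := norm_deriv_torusLoop (m := 1) 1 0 h t
    rw [← h1, ht] at h2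
    simp only [map_zero, norm_zero, zero_apply] at h2
    norm_num at h2
    exact absurd h2.symm (by positivity)

end smooth

lemma twice_torusLoop_one (h : (1 : ℝ) ^ 2 + 0 ^ 2 = 1) :
    twice (torusLoop 1 1 0 h) = torusLoop 2 1 0 h := by
  ext1 x
  refine Subtype.ext ?_
  change (torusLoop 1 1 0 h (x + x) : E4) = _
  simp [coe_torusLoop, unitLoop_add, pow_two]

/-! ### The metric and its short loops -/

/-- The polynomial `r² z - s w²`; for `s = √(1 - r²)` its zero set in the three-sphere is the curve
`z = s e²`, `w = r e` with `|e| = 1`, the boundary of a Möbius band with core `w = 0`. -/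
noncomputable def bandPoly (r s : ℝ) (x : E4) : ℂ := r ^ 2 * zCoord x - s * wCoord x ^ 2

/-- The conformal factor `A² |w|⁶ + B² |r² z - s w²|²`. The first term makes the part of the sphere
away from the circle `w = 0` expensive, the second one the part away from the zero set of
`r² z - s w²`. Only squares of norms occur, so that the factor is smooth. -/
noncomputable def factor (A B r s : ℝ) (x : E4) : ℝ :=
  A ^ 2 * (‖wCoord x‖ ^ 2) ^ 3 + B ^ 2 * ‖bandPoly r s x‖ ^ 2

lemma contDiff_bandPoly (r s : ℝ) : ContDiff ℝ ∞ (bandPoly r s) :=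
  (contDiff_const.mul zCoord.contDiff).sub (contDiff_const.mul (wCoord.contDiff.pow 2))

lemma contDiff_factor (A B r s : ℝ) : ContDiff ℝ ∞ (factor A B r s) :=
  (contDiff_const.mul ((wCoord.contDiff.norm_sq ℝ).pow 3)).add
    (contDiff_const.mul ((contDiff_bandPoly r s).norm_sq ℝ))

lemma contMDiff_factor (A B r s : ℝ) :
    ContMDiff (𝓡 3) 𝓘(ℝ, ℝ) ∞ (fun x : S3 => factor A B r s x) :=
  haveI := fact_finrank_E4
  (contDiff_factor A B r s).contMDiff.comp (contMDiff_coe_sphere (n := 3))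

lemma factor_pos {A B r : ℝ} (s : ℝ) (hA : 0 < A) (hB : 0 < B) (hr : 0 < r) (x : S3) :
    0 < factor A B r s x := by
  unfold factor
  by_cases hw : wCoord (x : E4) = 0
  · have hz : zCoord (x : E4) ≠ 0 := fun hz => by
      have := norm_sq_eq (x : E4)
      simp [hw, hz] at this
    have hQ : 0 < ‖bandPoly r s x‖ := norm_pos_iff.2 (by simp [bandPoly, hw, hz, hr.ne'])
    positivity
  · have := norm_pos_iff.2 hw
    positivity

lemma mul_norm_wCoord_le_sqrt_factor {A : ℝ} (B r s : ℝ) (x : E4) :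
    A * ‖wCoord x‖ ^ 3 ≤ √(factor A B r s x) := by
  refine Real.le_sqrt_of_sq_le ?_
  have : 0 ≤ B ^ 2 * ‖bandPoly r s x‖ ^ 2 := by positivity
  unfold factor
  nlinarith

lemma mul_norm_bandPoly_le_sqrt_factor (A : ℝ) {B : ℝ} (r s : ℝ) (x : E4) :
    B * ‖bandPoly r s x‖ ≤ √(factor A B r s x) := by
  refine Real.le_sqrt_of_sq_le ?_
  have : 0 ≤ A ^ 2 * (‖wCoord x‖ ^ 2) ^ 3 := by positivity
  unfold factor
  nlinarith

lemma sqrt_factor_le {A B : ℝ} (hA : 0 ≤ A) (hB : 0 ≤ B) (r s : ℝ) (x : E4) :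
    √(factor A B r s x) ≤ A * ‖wCoord x‖ ^ 3 + B * ‖bandPoly r s x‖ := by
  refine Real.sqrt_le_iff.2 ⟨by positivity, ?_⟩
  have : 0 ≤ (A * ‖wCoord x‖ ^ 3) * (B * ‖bandPoly r s x‖) := by positivity
  unfold factor
  nlinarith

/-- If `G` varies slowly for the metric with conformal factor `f`, then `G` and `z G` have small
oscillation on a short loop. If moreover `G` is large somewhere on the loop, then `z` is nearly
constant on the loop, and hence has a continuous square root. -/
lemma hasContinuousSqrt_of_loopLength_le {f : S3 → ℝ} {hf : ContMDiff (𝓡 3) 𝓘(ℝ, ℝ) ∞ f}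
    {hpos : ∀ x, 0 < f x} {G : E4 → ℂ} (G' : E4 → E4 →L[ℝ] ℂ) (ρ : S3 → ℝ)
    (hG : ContDiff ℝ 1 G) (hG' : ∀ x, HasFDerivAt G (G' x) x)
    (hρ : ∀ x : S3, ∀ v, ‖G' x v‖ ≤ ρ x * ‖v‖) (hρf : ∀ x : S3, ‖G x‖ + ρ x ≤ √(f x))
    {γ : C(UnitAddCircle, S3)} {d R : ℝ} (hd : 0 ≤ d)
    (hlen : loopLength (conformalMetric f hf hpos) γ ≤ ENNReal.ofReal d)
    (p : UnitAddCircle) (hR : R ≤ ‖G (γ p)‖) (hz : 2 * d < R * ‖zCoord (γ p)‖) :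
    HasContinuousSqrt fun q => zCoord (γ q) := by
  have hR0 : 0 < R := by
    by_contra! h
    nlinarith [norm_nonneg (zCoord (γ p : E4))]
  have hle : ∀ {u : ℂ} {q : UnitAddCircle},
      ‖u‖ₑ ≤ riemDist (conformalMetric f hf hpos) (γ p) (γ q) → ‖u‖ ≤ d := fun {u q} h => by
    have := (h.trans (riemDist_le_loopLength _ γ p q)).trans hlen
    rwa [← ofReal_norm, ENNReal.ofReal_le_ofReal_iff hd] at this
  have h1 : ∀ x y : S3, ‖G y - G x‖ₑ ≤ riemDist (conformalMetric f hf hpos) x y :=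
    enorm_sub_le_riemDist hG fun x v => by
      rw [(hG' x).fderiv]
      refine (hρ x v).trans (mul_le_mul_of_nonneg_right ?_ (norm_nonneg v))
      linarith [hρf x, norm_nonneg (G x)]
  have h2 : ∀ x y : S3, ‖zCoord y * G y - zCoord x * G x‖ₑ ≤
      riemDist (conformalMetric f hf hpos) x y :=
    enorm_sub_le_riemDist (H := fun x => zCoord x * G x) (zCoord.contDiff.mul hG) fun x v => by
      have hzG : HasFDerivAt (fun x => zCoord x * G x) _ (x : E4) :=
        zCoord.hasFDerivAt.mul (hG' x)
      rw [hzG.fderiv]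
      refine le_trans ?_ (mul_le_mul_of_nonneg_right (hρf x) (norm_nonneg v))
      simp only [smul_apply, add_apply, smul_eq_mul]
      refine (norm_add_le _ _).trans ?_
      rw [norm_mul, norm_mul, add_mul, add_comm]
      have hz1 : ‖zCoord (x : E4)‖ ≤ 1 := (norm_zCoord_le _).trans_eq (norm_coe_S3 _)
      have e1 := mul_le_mul_of_nonneg_left (norm_zCoord_le v) (norm_nonneg (G x))
      have e2 := mul_le_mul_of_nonneg_right hz1 (norm_nonneg (G' x v))
      linarith [hρ x v]
  refine (hasContinuousSqrt_const (zCoord (γ p : E4))).of_norm_sub_lt continuous_const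
    (by fun_prop) fun q => ?_
  have e1 := hle (h1 (γ p) (γ q))
  have e2 := hle (h2 (γ p) (γ q))
  have e3 : ‖zCoord (γ q : E4)‖ ≤ 1 := (norm_zCoord_le _).trans_eq (norm_coe_S3 _)
  have e4 : G (γ p) * (zCoord (γ q : E4) - zCoord (γ p : E4)) =
      (zCoord (γ q : E4) * G (γ q) - zCoord (γ p : E4) * G (γ p)) -
        zCoord (γ q : E4) * (G (γ q) - G (γ p)) := by ring
  have e5 : ‖G (γ p)‖ * ‖zCoord (γ q : E4) - zCoord (γ p : E4)‖ ≤ d + 1 * d := by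
    rw [← norm_mul, e4]
    refine (norm_sub_le _ _).trans (add_le_add e2 ?_)
    rw [norm_mul]
    gcongr
  have e6 := mul_le_mul_of_nonneg_right hR
    (norm_nonneg (zCoord (γ q : E4) - zCoord (γ p : E4)))
  by_contra! h
  have e7 := mul_le_mul_of_nonneg_left h hR0.le
  linarith

/-- The metric on the three-sphere conformal to the round one, with conformal factor `factor`. -/
noncomputable def bandMetric {A B r : ℝ} (s : ℝ) (hA : 0 < A) (hB : 0 < B) (hr : 0 < r) :
    RiemannianMetricOn (𝓡 3) S3 :=
  conformalMetric (fun x => factor A B r s x) (contMDiff_factor A B r s) (factor_pos s hA hB hr)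

section oscillation

variable {A B r s : ℝ} {hA : 0 < A} {hB : 0 < B} {hr : 0 < r} {γ : C(UnitAddCircle, S3)} {d : ℝ}

lemma hasContinuousSqrt_of_norm_wCoord (hd : 0 ≤ d)
    (hlen : loopLength (bandMetric s hA hB hr) γ ≤ ENNReal.ofReal d) (p : UnitAddCircle)
    (hz : 2 * d < A / 5 * ‖wCoord (γ p)‖ ^ 4 * ‖zCoord (γ p)‖) :
    HasContinuousSqrt fun q => zCoord (γ q) := by
  have hA5 : ‖((A / 5 : ℝ) : ℂ)‖ = A / 5 := by
    rw [Complex.norm_real, Real.norm_eq_abs, abs_of_pos (by positivity)]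
  refine hasContinuousSqrt_of_loopLength_le (G := fun x => (A / 5 : ℝ) * wCoord x ^ 4) _
    (fun x => 4 * (A / 5) * ‖wCoord x‖ ^ 3) (contDiff_const.mul (wCoord.contDiff.pow 4))
    (fun x => (wCoord.hasFDerivAt.pow 4).const_mul _) (fun x v => ?_) (fun x => ?_) hd hlen p
    (le_of_eq ?_) hz
  · have hv := mul_le_mul_of_nonneg_left (norm_wCoord_le v)
      (show 0 ≤ 4 * (A / 5) * ‖wCoord (x : E4)‖ ^ 3 by positivity)
    simp only [smul_apply, smul_eq_mul, norm_mul, hA5]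
    norm_num
    linarith
  · refine le_trans ?_ (mul_norm_wCoord_le_sqrt_factor B r s x)
    have hw : ‖wCoord (x : E4)‖ ≤ 1 := (norm_wCoord_le _).trans_eq (norm_coe_S3 _)
    have := mul_le_mul_of_nonneg_left hw (show 0 ≤ A / 5 * ‖wCoord (x : E4)‖ ^ 3 by positivity)
    rw [norm_mul, hA5, norm_pow]
    linarith
  · rw [norm_mul, hA5, norm_pow]

lemma hasContinuousSqrt_of_norm_bandPoly (hr1 : r ≤ 1) (hs : 0 ≤ s) (hs1 : s ≤ 1) (hd : 0 ≤ d)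
    (hlen : loopLength (bandMetric s hA hB hr) γ ≤ ENNReal.ofReal d) (p : UnitAddCircle)
    (hz : 2 * d < B / 8 * ‖bandPoly r s (γ p)‖ ^ 2 * ‖zCoord (γ p)‖) :
    HasContinuousSqrt fun q => zCoord (γ q) := by
  have hB8 : ‖((B / 8 : ℝ) : ℂ)‖ = B / 8 := by
    rw [Complex.norm_real, Real.norm_eq_abs, abs_of_pos (by positivity)]
  have hr' : ‖(r : ℂ) ^ 2‖ ≤ 1 := by
    rw [norm_pow, Complex.norm_real, Real.norm_eq_abs, abs_of_pos hr]
    exact pow_le_one₀ hr.le hr1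
  have hs' : ‖(s : ℂ)‖ ≤ 1 := by rwa [Complex.norm_real, Real.norm_eq_abs, abs_of_nonneg hs]
  have hQ' : ∀ x, HasFDerivAt (bandPoly r s) _ x := fun x =>
    (zCoord.hasFDerivAt.const_mul ((r : ℂ) ^ 2)).sub ((wCoord.hasFDerivAt.pow 2).const_mul (s : ℂ))
  refine hasContinuousSqrt_of_loopLength_le (G := fun x => (B / 8 : ℝ) * bandPoly r s x ^ 2) _
    (fun x => B / 8 * (2 * ‖bandPoly r s x‖ * 3))
    (contDiff_const.mul (((contDiff_bandPoly r s).of_le (by norm_num)).pow 2))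
    (fun x => ((hQ' x).pow 2).const_mul _) (fun x v => ?_) (fun x => ?_) hd hlen p
    (le_of_eq ?_) hz
  · have hw : ‖wCoord (x : E4)‖ ≤ 1 := (norm_wCoord_le _).trans_eq (norm_coe_S3 _)
    have hv : ‖(r : ℂ) ^ 2 * zCoord v - s * (2 * wCoord x * wCoord v)‖ ≤ 3 * ‖v‖ := by
      refine (norm_sub_le _ _).trans ?_
      have e1 : ‖(r : ℂ) ^ 2 * zCoord v‖ ≤ 1 * ‖v‖ := by
        rw [norm_mul]
        exact mul_le_mul hr' (norm_zCoord_le v) (norm_nonneg _) zero_le_one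
      have e2 : ‖(s : ℂ) * (2 * wCoord x * wCoord v)‖ ≤ 1 * (2 * 1 * ‖v‖) := by
        rw [norm_mul, norm_mul, norm_mul, Complex.norm_ofNat]
        gcongr
        exact norm_wCoord_le v
      linarith
    have := mul_le_mul_of_nonneg_left hv
      (show 0 ≤ B / 8 * (2 * ‖bandPoly r s (x : E4)‖) by positivity)
    simp only [smul_apply, sub_apply, smul_eq_mul, norm_mul, hB8]
    norm_num
    linarith
  · refine le_trans ?_ (mul_norm_bandPoly_le_sqrt_factor A r s x)
    have hz1 : ‖zCoord (x : E4)‖ ≤ 1 := (norm_zCoord_le _).trans_eq (norm_coe_S3 _)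
    have hw1 : ‖wCoord (x : E4)‖ ≤ 1 := (norm_wCoord_le _).trans_eq (norm_coe_S3 _)
    have hQ : ‖bandPoly r s (x : E4)‖ ≤ 1 * 1 + 1 * 1 ^ 2 := by
      refine (norm_sub_le _ _).trans ?_
      rw [norm_mul, norm_mul, norm_pow (wCoord _)]
      gcongr
    have := mul_le_mul_of_nonneg_left hQ
      (show 0 ≤ B / 8 * ‖bandPoly r s (x : E4)‖ by positivity)
    rw [norm_mul, hB8, norm_pow]
    linarith
  · rw [norm_mul, hB8, norm_pow]

/-- Where `|r² z - s w²| < r² |z|`, the square `s w²` is close to `r² z`, which therefore has a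
continuous square root. -/
lemma exists_le_norm_bandPoly (hr : 0 < r) (hodd : ¬ HasContinuousSqrt fun q => zCoord (γ q)) :
    ∃ p, r ^ 2 * ‖zCoord (γ p)‖ ≤ ‖bandPoly r s (γ p)‖ := by
  by_contra! h
  refine hodd ?_
  have hsq : HasContinuousSqrt fun q => (s : ℂ) * wCoord (γ q) ^ 2 :=
    (hasContinuousSqrt_const (s : ℂ)).mul ⟨fun q => wCoord (γ q), by fun_prop, fun _ => rfl⟩
  have h1 : HasContinuousSqrt fun q => (r : ℂ) ^ 2 * zCoord (γ q) := by
    refine hsq.of_norm_sub_lt' (by fun_prop) (by fun_prop) fun q => ?_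
    rw [norm_sub_rev, norm_mul, norm_pow, Complex.norm_real, Real.norm_eq_abs, sq_abs]
    exact h q
  have hr0 : (r : ℂ) ≠ 0 := by exact_mod_cast hr.ne'
  convert (hasContinuousSqrt_const (((r : ℂ) ^ 2)⁻¹)).mul h1 using 2 with q
  field_simp

/-- A loop on which `z` has no continuous square root and `|z| ≥ 1/2` cannot be short. -/
lemma le_loopLength_of_not_hasContinuousSqrt (hr1 : r ≤ 1) (hs : 0 ≤ s) (hs1 : s ≤ 1)
    (hz : ∀ q, 1 / 2 ≤ ‖zCoord (γ q)‖) (hodd : ¬ HasContinuousSqrt fun q => zCoord (γ q))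
    (hd : 0 ≤ d) (hdB : d < B * r ^ 4 / 128) :
    ENNReal.ofReal d < loopLength (bandMetric s hA hB hr) γ := by
  by_contra! h
  obtain ⟨p, hp⟩ := exists_le_norm_bandPoly (s := s) hr hodd
  refine hodd (hasContinuousSqrt_of_norm_bandPoly hr1 hs hs1 hd h p ?_)
  have h1 : r ^ 2 / 2 ≤ ‖bandPoly r s (γ p)‖ := by nlinarith [hz p, sq_nonneg r]
  calc 2 * d < B / 8 * (r ^ 2 / 2) ^ 2 * (1 / 2) := by linarith
    _ ≤ _ := by gcongr; exact hz p

end oscillation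

/-! ### The homotopy across the band and the loops that cannot leave it -/

lemma norm_wCoord_torusLoop (m : ℕ) (a b : ℝ) (h : a ^ 2 + b ^ 2 = 1) (x : UnitAddCircle) :
    ‖wCoord (torusLoop m a b h x)‖ = |b| := by
  rw [coe_torusLoop, wCoord_ofCoords, norm_mul, norm_unitLoop, mul_one, Complex.norm_real,
    Real.norm_eq_abs]

lemma norm_bandPoly_torusLoop_two (r s a b : ℝ) (h : a ^ 2 + b ^ 2 = 1) (x : UnitAddCircle) :
    ‖bandPoly r s (torusLoop 2 a b h x)‖ = |r ^ 2 * a - s * b ^ 2| := by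
  have : bandPoly r s (torusLoop 2 a b h x) =
      ((r ^ 2 * a - s * b ^ 2 : ℝ) : ℂ) * unitLoop x ^ 2 := by
    rw [bandPoly, coe_torusLoop, zCoord_ofCoords, wCoord_ofCoords]
    push_cast
    ring
  rw [this, norm_mul, norm_pow, norm_unitLoop, one_pow, mul_one, Complex.norm_real,
    Real.norm_eq_abs]

lemma norm_bandPoly_torusLoop_one (r s : ℝ) (h : (1 : ℝ) ^ 2 + 0 ^ 2 = 1) (x : UnitAddCircle) :
    ‖bandPoly r s (torusLoop 1 1 0 h x)‖ = r ^ 2 := by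
  rw [bandPoly, coe_torusLoop, zCoord_ofCoords, wCoord_ofCoords]
  simp [norm_unitLoop]

section length

variable {A B r s : ℝ} {hA : 0 < A} {hB : 0 < B} {hr : 0 < r}

lemma loopLength_torusLoop_le {m : ℕ} (hm : m ≤ 2) {a b : ℝ} (h : a ^ 2 + b ^ 2 = 1) {C D : ℝ}
    (hC : ∀ x, A * ‖wCoord (torusLoop m a b h x)‖ ^ 3 +
      B * ‖bandPoly r s (torusLoop m a b h x)‖ ≤ C) (hCD : 4 * Real.pi * C ≤ D) :
    loopLength (bandMetric s hA hB hr) (torusLoop m a b h) ≤ ENNReal.ofReal D := by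
  refine loopLength_le_of_speed_le ((contMDiff_torusLoop m a b h).of_le (by norm_num))
    fun t => ?_
  have hm' : (m : ℝ) ≤ 2 := by exact_mod_cast hm
  have hspeed : ‖deriv (fun t : ℝ => (torusLoop m a b h (t : UnitAddCircle) : E4)) t‖ ≤
      4 * Real.pi := by
    refine le_of_sq_le_sq ?_ (by positivity)
    rw [norm_deriv_torusLoop]
    have : ((m : ℝ) * a) ^ 2 + b ^ 2 ≤ 4 := by
      have h1 : (m : ℝ) ^ 2 ≤ 4 := by nlinarith [(Nat.cast_nonneg m : (0 : ℝ) ≤ m)]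
      nlinarith [sq_nonneg a, sq_nonneg b, mul_le_mul_of_nonneg_right h1 (sq_nonneg a)]
    nlinarith [mul_le_mul_of_nonneg_left this (sq_nonneg (2 * Real.pi))]
  have hf := (sqrt_factor_le hA.le hB.le r s (torusLoop m a b h t)).trans (hC t)
  have hC0 : 0 ≤ C := (Real.sqrt_nonneg _).trans hf
  calc _ ≤ C * (4 * Real.pi) := mul_le_mul hf hspeed (norm_nonneg _) hC0
    _ ≤ D := by linarith

end length

lemma sq_sqrt_one_sub_sq_add_sq {b : ℝ} (hb : 0 ≤ b) (hb1 : b ≤ 1) :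
    √(1 - b ^ 2) ^ 2 + b ^ 2 = 1 := by
  rw [Real.sq_sqrt (by nlinarith)]
  ring

/-- The homotopy, through concentric curves of a Möbius band, from the core of the band traversed
twice to the boundary of the band. -/
noncomputable def bandHomotopy {r : ℝ} (hr : 0 ≤ r) (hr1 : r ≤ 1)
    (h : (1 : ℝ) ^ 2 + 0 ^ 2 = 1) :
    ContinuousMap.Homotopy (torusLoop 2 1 0 h)
      (torusLoop 2 (√(1 - r ^ 2)) r (sq_sqrt_one_sub_sq_add_sq hr hr1)) where
  toFun p := torusLoop 2 (√(1 - (p.1 * r) ^ 2)) (p.1 * r)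
    (sq_sqrt_one_sub_sq_add_sq (mul_nonneg p.1.2.1 hr) (mul_le_one₀ p.1.2.2 hr hr1)) p.2
  continuous_toFun := by
    refine Continuous.subtype_mk (f := fun p : unitInterval × UnitAddCircle =>
      ofCoords ((√(1 - (p.1 * r) ^ 2) : ℝ) * unitLoop p.2 ^ 2,
        ((p.1 * r : ℝ) : ℂ) * unitLoop p.2)) ?_ _
    fun_prop
  map_zero_left x := Subtype.ext (by simp [coe_torusLoop])
  map_one_left x := Subtype.ext (by simp [coe_torusLoop])

section stuck

variable {A B r s : ℝ} {hA : 0 < A} {hB : 0 < B} {hr : 0 < r} {K : ℝ}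

/-- A loop of length at most `K` on which `z` has no continuous square root cannot touch the torus
`|z| = 1/2`: the metric is so large there that `z` would be nearly constant on the loop. -/
lemma half_lt_norm_zCoord {γ : C(UnitAddCircle, S3)} (hK : 0 < K) (hAK : 40 * K ≤ A)
    (hlen : loopLength (bandMetric s hA hB hr) γ ≤ ENNReal.ofReal K)
    (hz : ∀ q, 1 / 2 ≤ ‖zCoord (γ q)‖) (hodd : ¬ HasContinuousSqrt fun q => zCoord (γ q))
    (q : UnitAddCircle) : 1 / 2 < ‖zCoord (γ q)‖ := by
  refine lt_of_le_of_ne (hz q) fun h => hodd (hasContinuousSqrt_of_norm_wCoord hK.le hlen q ?_)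
  have h1 := norm_sq_eq (γ q : E4)
  rw [norm_coe_S3, ← h] at h1
  have h2 : ‖wCoord (γ q : E4)‖ ^ 4 = 9 / 16 := by
    have : ‖wCoord (γ q : E4)‖ ^ 2 = 3 / 4 := by linarith
    rw [show ‖wCoord (γ q : E4)‖ ^ 4 = (‖wCoord (γ q : E4)‖ ^ 2) ^ 2 by ring, this]
    norm_num
  rw [h2, ← h]
  linarith

/-- Along a homotopy through loops of length at most `K` that starts at the circle `w = 0`, the
function `z` never acquires a continuous square root. -/
lemma not_hasContinuousSqrt_of_homotopicThrough (hK : 0 < K) (hAK : 40 * K ≤ A)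
    {β : C(UnitAddCircle, S3)} (h : (1 : ℝ) ^ 2 + 0 ^ 2 = 1)
    (hβ : HomotopicThrough (bandMetric s hA hB hr) K (torusLoop 1 1 0 h) β) :
    (∀ q, 1 / 2 < ‖zCoord (β q)‖) ∧ ¬ HasContinuousSqrt fun q => zCoord (β q) := by
  obtain ⟨F, hF⟩ := hβ
  let zS : C(S3, ℂ) := ⟨fun x => zCoord x, by fun_prop⟩
  let G : C(unitInterval, C(UnitAddCircle, ℂ)) :=
    ⟨fun t => zS.comp (F.curry t), (ContinuousMap.continuous_postcomp zS).comp F.curry.continuous⟩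
  have hG0 : ∀ q, G 0 q = unitLoop q := fun q => by
    change zCoord (F (0, q)) = _
    rw [F.apply_zero, coe_torusLoop, zCoord_ofCoords]
    simp
  have hG1 : ∀ q, G 1 q = zCoord (β q) := fun q => by
    change zCoord (F (1, q)) = _
    rw [F.apply_one]
  have key := not_hasContinuousSqrt_of_path (c := 1 / 2) (by norm_num) G
    (fun t h1 h2 => half_lt_norm_zCoord hK hAK (hF t) h1 h2)
    (fun q => by rw [hG0, norm_unitLoop]; norm_num)
    (by rw [show ⇑(G 0) = unitLoop from funext hG0]; exact not_hasContinuousSqrt_unitLoop) 1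
  rw [show ⇑(G 1) = fun q => zCoord (β q) from funext hG1] at key
  exact key

end stuck

end CurveLength

open CurveLength in
theorem mainTheorem7 (K L : ℝ) (hL : 0 < L) (hKL : L < K) :
    ∃ (g : CurveLength.RiemannianMetricOn (𝓡 3) CurveLength.S3)
      (α : C(UnitAddCircle, CurveLength.S3)),
      CurveLength.IsSmoothSimpleClosed (𝓡 3) α ∧
      CurveLength.loopLength g α ≤ ENNReal.ofReal K ∧
      CurveLength.loopLength g (CurveLength.twice α) ≤ ENNReal.ofReal L ∧
      CurveLength.minLength g L (CurveLength.twice α) < CurveLength.minLength g K α := by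
  have hK : 0 < K := hL.trans hKL
  -- The width `r` of the band is chosen small enough for the boundary of the band, of length about
  -- `K r³`, to be much shorter than the lower bound of order `B r⁴ ~ L r²` for odd loops.
  obtain ⟨r, hr, hrK⟩ : ∃ r : ℝ, 0 < r ∧ K * r = L / 10 ^ 7 :=
    ⟨L / (10 ^ 7 * K), by positivity, by field_simp⟩
  have hr1 : r ≤ 1 / 10 ^ 7 := by nlinarith
  have hr1' : r ≤ 1 := hr1.trans (by norm_num)
  obtain ⟨B, hB, hBr⟩ : ∃ B : ℝ, 0 < B ∧ B * r ^ 2 = L / 26 :=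
    ⟨L / (26 * r ^ 2), by positivity, by field_simp⟩
  have hA : 0 < 40 * K := by positivity
  have hAr : 40 * K * r ^ 3 = 40 * (L * r ^ 2) / 10 ^ 7 := by
    linear_combination 40 * r ^ 2 * hrK
  have hr2 : r ^ 2 ≤ 1 := pow_le_one₀ hr.le hr1'
  have hLr : 0 < L * r ^ 2 := by positivity
  have hLr2 : L * r ^ 2 ≤ L := mul_le_of_le_one_right hL.le hr2
  have hpi := Real.pi_lt_d2
  have hpi0 := Real.pi_pos
  have hs0 : 0 ≤ √(1 - r ^ 2) := Real.sqrt_nonneg _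
  have hs1 : √(1 - r ^ 2) ≤ 1 := Real.sqrt_le_one.2 (by nlinarith)
  have h10 : (1 : ℝ) ^ 2 + 0 ^ 2 = 1 := by norm_num
  have htotal : 4 * Real.pi * (40 * K * r ^ 3 + B * r ^ 2) ≤ L := by
    rw [hAr, hBr]
    nlinarith
  -- the curves of the band
  have hband : ∀ b (hb : 0 ≤ b) (hbr : b ≤ r), loopLength (bandMetric (√(1 - r ^ 2)) hA hB hr)
      (torusLoop 2 (√(1 - b ^ 2)) b (sq_sqrt_one_sub_sq_add_sq hb (hbr.trans hr1'))) ≤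
      ENNReal.ofReal L := fun b hb hbr => by
    refine loopLength_torusLoop_le le_rfl _ (fun x => ?_) htotal
    rw [norm_wCoord_torusLoop, norm_bandPoly_torusLoop_two, abs_of_nonneg hb]
    have e1 : √(1 - b ^ 2) ≤ 1 := Real.sqrt_le_one.2 (by nlinarith)
    have e2 : 0 ≤ r ^ 2 * √(1 - b ^ 2) := by positivity
    have e3 : r ^ 2 * √(1 - b ^ 2) ≤ r ^ 2 := mul_le_of_le_one_right (by positivity) e1
    have e4 : 0 ≤ √(1 - r ^ 2) * b ^ 2 := by positivity
    have e5 : √(1 - r ^ 2) * b ^ 2 ≤ 1 * r ^ 2 := by gcongr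
    have e6 : |r ^ 2 * √(1 - b ^ 2) - √(1 - r ^ 2) * b ^ 2| ≤ r ^ 2 :=
      abs_le.2 ⟨by linarith, by linarith⟩
    gcongr
  refine ⟨bandMetric (√(1 - r ^ 2)) hA hB hr, torusLoop 1 1 0 h10,
    isSmoothSimpleClosed_torusLoop_one h10, ?_, ?_, ?_⟩
  · refine (loopLength_torusLoop_le one_le_two h10 (C := B * r ^ 2) (fun x => ?_) ?_).trans
      (ENNReal.ofReal_le_ofReal hKL.le)
    · rw [norm_wCoord_torusLoop, norm_bandPoly_torusLoop_one]
      simp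
    · rw [hBr]
      nlinarith
  · rw [twice_torusLoop_one]
    simpa using hband 0 le_rfl hr.le
  · have hupper : minLength (bandMetric (√(1 - r ^ 2)) hA hB hr) L (twice (torusLoop 1 1 0 h10)) ≤
        ENNReal.ofReal (L * r ^ 2 / 5000) := by
      rw [twice_torusLoop_one]
      refine (iInf₂_le _ ⟨bandHomotopy hr.le hr1' h10, fun t => hband (t * r)
        (mul_nonneg t.2.1 hr.le) (mul_le_of_le_one_left hr.le t.2.2)⟩).trans ?_
      refine loopLength_torusLoop_le (C := 40 * K * r ^ 3) le_rfl _ (fun x => ?_) ?_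
      · rw [norm_wCoord_torusLoop, norm_bandPoly_torusLoop_two, abs_of_pos hr,
          mul_comm (r ^ 2), sub_self]
        simp
      · rw [hAr]
        nlinarith
    have hlower : ENNReal.ofReal (L * r ^ 2 / 4000) ≤
        minLength (bandMetric (√(1 - r ^ 2)) hA hB hr) K (torusLoop 1 1 0 h10) := by
      refine le_iInf₂ fun β hβ => ?_
      obtain ⟨hz, hodd⟩ := not_hasContinuousSqrt_of_homotopicThrough hK le_rfl h10 hβ
      refine (le_loopLength_of_not_hasContinuousSqrt hr1' hs0 hs1 (fun q => (hz q).le) hodd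
        (by positivity) ?_).le
      rw [show B * r ^ 4 = B * r ^ 2 * r ^ 2 by ring, hBr]
      linarith
    refine (hupper.trans_lt ?_).trans_le hlower
    rw [ENNReal.ofReal_lt_ofReal_iff (by positivity)]
    linarith
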